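/- Let $X$ be a two-dimensional real normed space whose closed unit ball $BX$ is a polygon with finitely many sides. Choosing two linearly independent vectors $e_1,e_2\in X$ gives coordinates $x=x_1e_1+x_2e_2$ on $X$; the slope, in these coordinates, of a side of $BX$ lying on the line $u_1x_1+u_2x_2+u_0=0$ is $-u_1/u_2$ if $u_2\neq 0$, and $\infty$ if $u_2=0$. The value $\infty$ is counted as algebraic. Suppose that there is no choice of $e_1,e_2$ for which the slopes of all sides of $BX$ are algebraic. Let $S\subset X$ be well-distributed, that is, suppose there is a constant $K$ such that for every $x\in X$ there is $y\in S$ with $\|x-y\|_X\le K$. For a positive integer $N$ put $$\Delta_{X,N}(S)=\{\|a-a'\|_X : a,a'\in S,\ \|a-a'\|_X\le N\}.$$ Then there is a constant $c>0$, depending only on $X$ and $S$, such that $$|\Delta_{X,N}(S)|\ \ge\ c\,\frac{N\log N}{\log\log N}\qquad\text{for all integers } N\ge 3,$$ where the inequality is considered to hold if $\Delta_{X,N}(S)$ is infinite. -/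

import Mathlib

open scoped ENNReal

noncomputable section

namespace PolygonalNorm

variable {E : Type*} [NormedAddCommGroup E] [NormedSpace ℝ E]

/-- The closed unit ball of `E` is a polygon with finitely many sides, i.e. it is the convex hull
of a finite set. (Used for two-dimensional `E`.) -/
def UnitBallIsPolygon (E : Type*) [NormedAddCommGroup E] [NormedSpace ℝ E] : Prop :=
  ∃ F : Set E, F.Finite ∧ Metric.closedBall (0 : E) 1 = convexHull ℝ F

/-- `[p, q]` is a side of the unit ball: `p` and `q` are two distinct vertices (extreme points)
of the unit ball and the segment joining them lies on the boundary of the unit ball. -/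
def IsSide (p q : E) : Prop :=
  p ≠ q ∧
  p ∈ Set.extremePoints ℝ (Metric.closedBall (0 : E) 1) ∧
  q ∈ Set.extremePoints ℝ (Metric.closedBall (0 : E) 1) ∧
  segment ℝ p q ⊆ Metric.sphere (0 : E) 1

open Classical in
/-- The slope of the line through `p` and `q` (for `p ≠ q`) in the coordinate system
`x = x₁ e₁ + x₂ e₂` given by the basis `e = (e₁, e₂)`; it is `∞` for a line `x₁ = const`. -/
def sideSlope (e : Module.Basis (Fin 2) ℝ E) (p q : E) : OnePoint ℝ :=
  if e.repr (q - p) 0 = 0 then OnePoint.infty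
  else ((e.repr (q - p) 1 / e.repr (q - p) 0 : ℝ) : OnePoint ℝ)

/-- A slope is algebraic if it is an algebraic real number or `∞`. -/
def IsAlgebraicSlope (s : OnePoint ℝ) : Prop :=
  s = OnePoint.infty ∨ ∃ r : ℝ, s = (r : OnePoint ℝ) ∧ IsAlgebraic ℚ r

/-- There is a coordinate system in which the slopes of all sides of the unit ball are
algebraic. -/
def HasAlgebraicSlopes (E : Type*) [NormedAddCommGroup E] [NormedSpace ℝ E] : Prop :=
  ∃ e : Module.Basis (Fin 2) ℝ E, ∀ p q : E, IsSide p q → IsAlgebraicSlope (sideSlope e p q)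

/-- `S` is well-distributed: for some `K`, every closed ball of radius `K` meets `S`. -/
def WellDistributed (S : Set E) : Prop :=
  ∃ K : ℝ, ∀ x : E, ∃ y ∈ S, ‖x - y‖ ≤ K

/-- The set of distances between points of `S` that are at most `N`. -/
def distancesUpTo (S : Set E) (N : ℕ) : Set ℝ :=
  {d | d ≤ N ∧ ∃ a ∈ S, ∃ b ∈ S, d = ‖a - b‖}

end PolygonalNorm

end

/-!
Let `κ` be the ratio of the number of distances up to `N` to `N`. The claim amounts to
`log N = O(κ log κ)`.

If the slopes are not algebraic in any coordinate system, adapting the coordinates to three sides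
produces a fourth side with transcendental slope (`exists_four_functionals`). Near a suitable
direction the norm equals the functional of a given side, so if `X` and `Y` are pieces of `S` of
diameter comparable to `N` which are displaced in this direction, then `φ(X) - φ(Y)` consists of
distances. A piece `X` of `S` that resembles an `N × N` grid therefore has the following properties
for the functionals `f`, `g`, `g + ρ f`, `g + ρ' f` of the four sides, up to constant factors.

* The rational dimension of `f(X)` is at most `κ`. This is Freiman's lemma for sums `A + B` of sets
  of reals: removing the maxima of both sets loses as many sums as the dimension, and this can be
  repeated about `N` times (`mul_finrank_vectorSpan_le_card_add`). The bound has to be linear in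
  `κ`, since it becomes the factor `κ` in `log N = O(κ log κ)`; everywhere else a loss of a fixed
  power of `κ` is harmless.
* The difference sets of `f(X)` and `g(X)` have size at most `κ ^ 2 * N`, by the Ruzsa triangle
  inequality, and the images under the other two functionals have size at most `κ * N`. Popular
  values of `g + ρ f` and `g + ρ' f` then yield a set `E ⊆ f(X)` with `|E| ≥ N / κ` and
  `|E - (ρ' / ρ) E| ≤ κ ^ 6 |E|` (`log_le_mul_log_of_small_projections`).

Finally, a set `E` of rational dimension `d` with `|E - α E| ≤ K |E|` for a transcendental `α`
has at most `K ^ d` elements (`card_le_pow_of_card_sub_smul_le`). Such a set can be modelled by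
sequences so that multiplication by `α` becomes the shift. Iterating the triangle inequality `d`
times bounds the difference of `E` and its `d`-fold shift by `K ^ d |E|`, but these differences are
all distinct. Hence `N / κ ≤ κ ^ (6 * κ)`, up to constants.
-/

open scoped Pointwise

namespace PolygonalNorm

/-! ### Sums of finite sets of reals and rational dimension -/

/-- Removing the maxima `a` of `A` and `b` of `B` loses at least as many sums as the rational
dimension of `A`. Let `C` consist of the positive differences `a - x` and `b - y`. An element of `C`
which is not the sum of two elements of `C` corresponds to a sum in `A + B` that needs `a` or `b`,
and such indecomposable elements span everything that `C` spans. -/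
theorem card_erase_max_add_finrank_le (A B : Finset ℝ) (hA : A.Nonempty) (hB : B.Nonempty) :
    (A.erase (A.max' hA) + B.erase (B.max' hB)).card +
      Module.finrank ℚ (vectorSpan ℚ (A : Set ℝ)) ≤ (A + B).card := by
  classical
  set a := A.max' hA with ha
  set b := B.max' hB with hb
  have haA : a ∈ A := A.max'_mem hA
  have hbB : b ∈ B := B.max'_mem hB
  set C : Finset ℝ := (A.erase a).image (fun x => a - x) ∪ (B.erase b).image (fun x => b - x)
    with hC
  have hCpos : ∀ c ∈ C, 0 < c := by
    intro c hc
    rcases Finset.mem_union.1 hc with h | h <;> obtain ⟨x, hx, rfl⟩ := Finset.mem_image.1 h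
    · exact sub_pos.2 (lt_of_le_of_ne (A.le_max' x (Finset.mem_of_mem_erase hx))
        (Finset.ne_of_mem_erase hx))
    · exact sub_pos.2 (lt_of_le_of_ne (B.le_max' x (Finset.mem_of_mem_erase hx))
        (Finset.ne_of_mem_erase hx))
  set I : Finset ℝ := C.filter (fun c => ∀ x ∈ C, ∀ y ∈ C, x + y ≠ c) with hI
  have hCI : ∀ c ∈ C, c ∈ Submodule.span ℚ (I : Set ℝ) := by
    by_contra! hcon
    -- A minimal element outside the span would be a sum of two smaller elements of the span
    have hne : (C.filter (fun c => c ∉ Submodule.span ℚ (I : Set ℝ))).Nonempty := by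
      obtain ⟨c, hc, h⟩ := hcon
      exact ⟨c, Finset.mem_filter.2 ⟨hc, h⟩⟩
    obtain ⟨hcC, hc⟩ := Finset.mem_filter.1 (Finset.min'_mem _ hne)
    have hlt : ∀ x ∈ C, x < Finset.min' _ hne → x ∈ Submodule.span ℚ (I : Set ℝ) := by
      intro x hx hlt
      by_contra h
      exact absurd (Finset.min'_le _ x (Finset.mem_filter.2 ⟨hx, h⟩)) (not_le.2 hlt)
    have hnI : Finset.min' _ hne ∉ I := fun h => hc (Submodule.subset_span h)
    have : ∃ x ∈ C, ∃ y ∈ C, x + y = Finset.min' _ hne := by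
      by_contra! h
      exact hnI (Finset.mem_filter.2 ⟨hcC, h⟩)
    obtain ⟨x, hx, y, hy, hxy⟩ := this
    have hx0 := hCpos x hx
    have hy0 := hCpos y hy
    apply hc
    rw [← hxy]
    exact add_mem (hlt x hx (by linarith)) (hlt y hy (by linarith))
  have hspan : vectorSpan ℚ (A : Set ℝ) ≤ Submodule.span ℚ (I : Set ℝ) := by
    rw [vectorSpan_eq_span_vsub_set_right ℚ (show a ∈ (A : Set ℝ) from haA), Submodule.span_le]
    rintro _ ⟨x, hx, rfl⟩
    by_cases hxa : x = a
    · subst hxa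
      simp
    · have hmem := hCI (a - x) (Finset.mem_union_left _
        (Finset.mem_image.2 ⟨x, Finset.mem_erase.2 ⟨hxa, hx⟩, rfl⟩))
      have := Submodule.neg_mem _ hmem
      simpa using this
  have hdim : Module.finrank ℚ (vectorSpan ℚ (A : Set ℝ)) ≤ I.card := by
    have : Module.Finite ℚ (Submodule.span ℚ (I : Set ℝ)) :=
      FiniteDimensional.span_finset ℚ I
    exact (Submodule.finrank_mono hspan).trans (finrank_span_finset_le_card I)
  have hdisj : Disjoint (A.erase a + B.erase b) (I.image (fun c => a + b - c)) := by
    rw [Finset.disjoint_left]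
    intro z hz hz'
    obtain ⟨x, hx, y, hy, rfl⟩ := Finset.mem_add.1 hz
    obtain ⟨c, hc, hcz⟩ := Finset.mem_image.1 hz'
    refine (Finset.mem_filter.1 hc).2 (a - x)
      (Finset.mem_union_left _ (Finset.mem_image_of_mem _ hx)) (b - y)
      (Finset.mem_union_right _ (Finset.mem_image_of_mem _ hy)) ?_
    linarith
  have hsub : (A.erase a + B.erase b) ∪ I.image (fun c => a + b - c) ⊆ A + B := by
    refine Finset.union_subset
      (Finset.add_subset_add (Finset.erase_subset _ _) (Finset.erase_subset _ _)) ?_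
    intro z hz
    obtain ⟨c, hc, rfl⟩ := Finset.mem_image.1 hz
    rcases Finset.mem_union.1 (Finset.mem_filter.1 hc).1 with h | h <;>
      obtain ⟨x, hx, rfl⟩ := Finset.mem_image.1 h
    · exact Finset.mem_add.2 ⟨x, Finset.mem_of_mem_erase hx, b, hbB, by ring⟩
    · exact Finset.mem_add.2 ⟨a, haA, x, Finset.mem_of_mem_erase hx, by ring⟩
  calc _ ≤ (A.erase a + B.erase b).card + (I.image (fun c => a + b - c)).card := by
        rw [Finset.card_image_of_injective I (fun x y h => by simpa using h)]
        exact Nat.add_le_add_left hdim _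
    _ = _ := (Finset.card_union_of_disjoint hdisj).symm
    _ ≤ _ := Finset.card_le_card hsub

/-- A form of Freiman's lemma: if `k` elements of `A` lie above all of `A' ⊆ A`, then the
maxima of `A` and `B` can be removed `k` times before `A'` is touched, and each removal loses at
least as many sums as the rational dimension of `A'`. -/
theorem mul_finrank_vectorSpan_le_card_add (k : ℕ) (A B A' : Finset ℝ) (hA' : A' ⊆ A)
    (hB : k ≤ B.card) (hA : k ≤ (A.filter (fun x => ∀ y ∈ A', y < x)).card) :
    k * Module.finrank ℚ (vectorSpan ℚ (A' : Set ℝ)) ≤ (A + B).card := by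
  classical
  induction k generalizing A B with
  | zero => simp
  | succ k ih =>
    have hBne : B.Nonempty := Finset.card_pos.1 (by omega)
    obtain ⟨x, hx⟩ : (A.filter (fun x => ∀ y ∈ A', y < x)).Nonempty :=
      Finset.card_pos.1 (by omega)
    obtain ⟨hxA, hx⟩ := Finset.mem_filter.1 hx
    have hAne : A.Nonempty := ⟨x, hxA⟩
    have hlt : ∀ y ∈ A', y < A.max' hAne := fun y hy => (hx y hy).trans_le (A.le_max' x hxA)
    have h1 := card_erase_max_add_finrank_le A B hAne hBne
    have h2 := ih (A.erase (A.max' hAne)) (B.erase (B.max' hBne))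
      (fun y hy => Finset.mem_erase.2 ⟨(hlt y hy).ne, hA' hy⟩)
      (by rw [Finset.card_erase_of_mem (B.max'_mem hBne)]; omega)
      (by
        rw [Finset.filter_erase, Finset.card_erase_of_mem
          (Finset.mem_filter.2 ⟨A.max'_mem hAne, hlt⟩)]
        omega)
    have h3 : Module.finrank ℚ (vectorSpan ℚ (A' : Set ℝ)) ≤
        Module.finrank ℚ (vectorSpan ℚ (A : Set ℝ)) := by
      have : FiniteDimensional ℚ (vectorSpan ℚ (A : Set ℝ)) :=
        finiteDimensional_vectorSpan_of_finite ℚ A.finite_toSet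
      exact Submodule.finrank_mono (vectorSpan_mono ℚ (by exact_mod_cast hA'))
    rw [Nat.succ_mul]
    omega

/-! ### Small sums with a transcendental dilate -/

theorem card_sub_comm {G : Type*} [AddCommGroup G] [DecidableEq G] (A B : Finset G) :
    (A - B).card = (B - A).card := by
  rw [← neg_sub B A, Finset.card_neg]

/-- If `w ≠ 0`, the numbers `w, α w, …, α ^ d w` are linearly independent over `ℚ`, so they do
not fit into a space of dimension `d`. -/
theorem eq_zero_of_forall_pow_mul_mem {α : ℝ} (hα : Transcendental ℚ α) (V : Submodule ℚ ℝ)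
    [FiniteDimensional ℚ V] {w : ℝ} (hw : ∀ i ≤ Module.finrank ℚ V, α ^ i * w ∈ V) : w = 0 := by
  by_contra hw0
  set d := Module.finrank ℚ V
  let g : Polynomial ℚ →ₗ[ℚ] ℝ :=
    (LinearMap.mulRight ℚ w).comp (Polynomial.aeval α).toLinearMap
  have hg : Function.Injective g := by
    intro p q h
    exact (transcendental_iff_injective.1 hα) (mul_right_cancel₀ hw0 h)
  have hli := ((Polynomial.basisMonomials ℚ).linearIndependent.map' g
    (LinearMap.ker_eq_bot.2 hg)).comp (fun i : Fin (d + 1) => (i : ℕ)) Fin.val_injective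
  have hli' : LinearIndependent ℚ
      (fun i : Fin (d + 1) => (⟨α ^ (i : ℕ) * w, hw i (by omega)⟩ : V)) := by
    apply LinearIndependent.of_comp V.subtype
    have heq : (V.subtype ∘ fun i : Fin (d + 1) => (⟨α ^ (i : ℕ) * w, hw i (by omega)⟩ : V)) =
        (g ∘ Polynomial.basisMonomials ℚ) ∘ fun i : Fin (d + 1) => (i : ℕ) := by
      funext i
      simp [g]
    rw [heq]
    exact hli
  have := hli'.fintype_card_le_finrank
  simp only [Fintype.card_fin] at this
  omega

/-- A rational linear map `s` into `V` that divides by `α` every element of `V ∩ α V`. -/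
theorem exists_division {α : ℝ} (hα : α ≠ 0) (V : Submodule ℚ ℝ) :
    ∃ s : ℝ →ₗ[ℚ] ℝ, (∀ x, s x ∈ V) ∧ ∀ v ∈ V, α * v ∈ V → s (α * v) = v := by
  let V₁ : Submodule ℚ ℝ := V ⊓ V.comap (LinearMap.mulLeft ℚ α)
  let τ : V₁ →ₗ[ℚ] ℝ := (LinearMap.mulLeft ℚ α).comp V₁.subtype
  have hτ : LinearMap.ker τ = ⊥ := by
    rw [LinearMap.ker_eq_bot]
    intro x y h
    exact Subtype.ext (mul_left_cancel₀ hα h)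
  obtain ⟨s, hs⟩ := τ.exists_leftInverse_of_injective hτ
  refine ⟨V₁.subtype.comp s, fun x => (s x).2.1, fun v hv hαv => ?_⟩
  have := LinearMap.congr_fun hs (⟨v, hv, hαv⟩ : V₁)
  exact congrArg Subtype.val this

/-- The shift `(g₀, g₁, …) ↦ (0, g₀, g₁, …)` on sequences, i.e. multiplication by the variable
on formal power series. -/
def shift : (ℕ → ℝ) →+ (ℕ → ℝ) where
  toFun g i := if i = 0 then 0 else g (i - 1)
  map_zero' := by ext i; simp
  map_add' f g := by ext i; by_cases h : i = 0 <;> simp [h]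

theorem shift_injective : Function.Injective shift := by
  intro f g h
  ext i
  simpa [shift] using congrFun h (i + 1)

theorem shift_iterate_apply_of_lt (g : ℕ → ℝ) (k i : ℕ) (h : i < k) : (shift^[k] g) i = 0 := by
  induction k generalizing i with
  | zero => omega
  | succ k ih =>
    rw [Function.iterate_succ_apply']
    by_cases hi : i = 0
    · simp [shift, hi]
    · simpa [shift, hi] using ih (i - 1) (by omega)

/-- A linear model of the partially defined multiplication by `α` on `V`, in which it becomes the
everywhere defined shift of sequences. With `s` as in `exists_division`, the model sends `v` to the
coefficients `sⁱ v - α sⁱ⁺¹ v` of its expansion in powers of `α`. An element of `V` is determined by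
its first `dim V` coefficients, because `α` is transcendental. -/
theorem exists_shift_model {α : ℝ} (hα : Transcendental ℚ α) (V : Submodule ℚ ℝ)
    [FiniteDimensional ℚ V] :
    ∃ φ : ℝ →+ (ℕ → ℝ), (∀ v ∈ V, α * v ∈ V → φ (α * v) = shift (φ v)) ∧
      ∀ v ∈ V, (∀ i < Module.finrank ℚ V, φ v i = 0) → v = 0 := by
  have hα0 : α ≠ 0 := fun h => hα (h ▸ isAlgebraic_zero)
  obtain ⟨s, hsV, hs⟩ := exists_division hα0 V
  let φ : ℝ →+ (ℕ → ℝ) :=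
    { toFun := fun v i => (s ^ i) v - α * (s ^ (i + 1)) v
      map_zero' := by ext i; simp
      map_add' := fun x y => by ext i; simp only [map_add, Pi.add_apply]; ring }
  have hφ : ∀ v i, φ v i = (s ^ i) v - α * (s ^ (i + 1)) v := fun v i => rfl
  refine ⟨φ, fun v hv hαv => ?_, fun v hv h => ?_⟩
  · ext i
    rcases i with _ | i
    · rw [hφ]
      simp [shift, hs v hv hαv]
    · rw [hφ, pow_succ, pow_succ, Module.End.mul_apply, Module.End.mul_apply, hs v hv hαv]
      simp [shift, hφ]
  · set d := Module.finrank ℚ V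
    -- The vanishing conditions unwind to `v = α ^ i * s ^ i v` for all `i ≤ d`
    have hstep : ∀ j ≤ d, (s ^ (d - j)) v = α ^ j * (s ^ d) v := by
      intro j
      induction j with
      | zero => intro _; simp
      | succ j ih =>
        intro hj
        have h1 := h (d - (j + 1)) (by omega)
        rw [hφ, show d - (j + 1) + 1 = d - j by omega, ih (by omega)] at h1
        rw [pow_succ]
        linarith
    have hmem : ∀ i, (s ^ i) v ∈ V := by
      intro i
      rcases i with _ | i
      · simpa using hv
      · rw [pow_succ', Module.End.mul_apply]
        exact hsV _
    have h0 : (s ^ d) v = 0 := eq_zero_of_forall_pow_mul_mem hα V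
      (fun i hi => hstep i hi ▸ hmem _)
    have := hstep d le_rfl
    simpa [h0] using this

/-- A finite set `E` of rational dimension `d` with `|E - α E| ≤ κ |E|`, `α` transcendental, has
at most `κ ^ d` elements. In the sequence model `F` of `E`, the Ruzsa triangle inequality along
`F, shift F, …, shift^d F` gives `|F - shift^d F| ≤ κ ^ d |F|`, while all `|F| ^ 2` of these
differences are distinct. The chain cannot be run in `ℝ` itself, where `V ∩ α ^ d V` may be
nonzero. -/
theorem card_le_pow_of_card_sub_smul_le {α : ℝ} (hα : Transcendental ℚ α) (V : Submodule ℚ ℝ)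
    [FiniteDimensional ℚ V] (E : Finset ℝ) (hE : ∀ x ∈ E, ∀ y ∈ E, x - y ∈ V)
    (hne : E.Nonempty) {κ : ℝ}
    (hκ : ((E - E.image (α * ·)).card : ℝ) ≤ κ * E.card) :
    (E.card : ℝ) ≤ κ ^ Module.finrank ℚ V := by
  classical
  obtain ⟨φ, hφ, hφ0⟩ := exists_shift_model hα V
  set d := Module.finrank ℚ V
  have hpos : (0 : ℝ) < E.card := by exact_mod_cast hne.card_pos
  have hκ0 : 0 ≤ κ := by
    by_contra! h
    have : (0 : ℝ) ≤ (E - E.image (α * ·)).card := by positivity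
    nlinarith
  have hinj : ∀ x ∈ E, ∀ y ∈ E, (∀ i < d, φ (x - y) i = 0) → x = y := fun x hx y hy h =>
    sub_eq_zero.1 (hφ0 _ (hE x hx y hy) h)
  set F : Finset (ℕ → ℝ) := E.image φ with hF
  have hFcard : F.card = E.card := by
    refine Finset.card_image_of_injOn fun x hx y hy h => hinj x hx y hy fun i _ => ?_
    have h : φ x = φ y := h
    rw [map_sub, h, sub_self]
    rfl
  have hbase : (F - F.image shift).card ≤ (E - E.image (α * ·)).card := by
    refine Finset.card_le_card_of_forall_subsingleton
      (fun z y => ∃ e ∈ E, ∃ e' ∈ E, z = φ e - shift (φ e') ∧ y = e - α * e') ?_ ?_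
    · intro z hz
      obtain ⟨_, h1, _, h2, rfl⟩ := Finset.mem_sub.1 hz
      obtain ⟨e, he, rfl⟩ := Finset.mem_image.1 h1
      obtain ⟨_, h3, rfl⟩ := Finset.mem_image.1 h2
      obtain ⟨e', he', rfl⟩ := Finset.mem_image.1 h3
      exact ⟨e - α * e', Finset.sub_mem_sub he (Finset.mem_image_of_mem _ he'), e, he, e', he',
        rfl, rfl⟩
    · rintro y - z₁ ⟨-, a, ha, b, hb, rfl, rfl⟩ z₂ ⟨-, c, hc, e, he, rfl, h⟩
      have h1 : a - c = α * (b - e) := by linarith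
      have h2 := hφ (b - e) (hE b hb e he) (h1 ▸ hE a ha c hc)
      rw [← h1] at h2
      simp only [map_sub] at h2
      rw [sub_eq_sub_iff_sub_eq_sub]
      exact h2
  have hshift : ∀ k, Function.Injective shift^[k] := fun k => shift_injective.iterate k
  have hsub : ∀ k x y, shift^[k] (x - y) = shift^[k] x - shift^[k] y := fun k x y =>
    iterate_map_sub shift k x y
  have hchain : ∀ k, ((F - F.image shift^[k + 1]).card : ℝ) ≤ κ ^ (k + 1) * F.card := by
    intro k
    induction k with
    | zero =>
      rw [hFcard]
      simpa using (Nat.cast_le.2 hbase).trans hκ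
    | succ k ih =>
      have htri := Finset.ruzsa_triangle_inequality_sub_sub_sub F (F.image shift^[k + 1])
        (F.image shift^[k + 1 + 1])
      have heq : F.image shift^[k + 1] - F.image shift^[k + 1 + 1] =
          (F - F.image shift).image shift^[k + 1] := by
        ext z
        simp only [Finset.mem_sub, Finset.mem_image]
        constructor
        · rintro ⟨_, ⟨a, ha, rfl⟩, _, ⟨b, hb, rfl⟩, rfl⟩
          exact ⟨a - shift b, ⟨a, ha, _, ⟨b, hb, rfl⟩, rfl⟩, by
            rw [hsub, ← Function.iterate_succ_apply shift (k + 1) b]⟩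
        · rintro ⟨_, ⟨a, ha, _, ⟨b, hb, rfl⟩, rfl⟩, rfl⟩
          exact ⟨_, ⟨a, ha, rfl⟩, _, ⟨b, hb, rfl⟩, by
            rw [hsub, ← Function.iterate_succ_apply shift (k + 1) b]⟩
      rw [card_sub_comm (F.image shift^[k + 1 + 1]), heq,
        Finset.card_image_of_injective _ (hshift _),
        Finset.card_image_of_injective _ (hshift _)] at htri
      have htri' : ((F - F.image shift^[k + 1 + 1]).card : ℝ) * F.card ≤
          (F - F.image shift^[k + 1]).card * (F - F.image shift).card := by exact_mod_cast htri
      have hb : ((F - F.image shift).card : ℝ) ≤ κ * F.card := by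
        rw [hFcard]
        exact (Nat.cast_le.2 hbase).trans hκ
      have hFpos : (0 : ℝ) < F.card := by rw [hFcard]; exact hpos
      refine le_of_mul_le_mul_right ?_ hFpos
      calc _ ≤ _ := htri'
        _ ≤ (κ ^ (k + 1) * F.card) * (κ * F.card) := by gcongr
        _ = _ := by ring
  -- The chain bounds `F - shift^[d] F` only for `d ≥ 1`.
  rcases Nat.eq_zero_or_pos d with hd | hd
  · rw [hd, pow_zero]
    have : E.card ≤ 1 := Finset.card_le_one.2 fun x hx y hy =>
      hinj x hx y hy (fun i hi => by omega)
    exact_mod_cast this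
  · have hbig : F.card * F.card ≤ (F - F.image shift^[d]).card := by
      rw [hFcard, ← Finset.card_product]
      refine Finset.card_le_card_of_injOn (fun p => φ p.1 - shift^[d] (φ p.2)) ?_ ?_
      · intro p hp
        have hp := Finset.mem_product.1 (Finset.mem_coe.1 hp)
        exact Finset.sub_mem_sub (Finset.mem_image_of_mem _ hp.1)
          (Finset.mem_image_of_mem _ (Finset.mem_image_of_mem _ hp.2))
      · rintro ⟨a, b⟩ hp ⟨c, e⟩ hq h
        obtain ⟨ha, hb⟩ := Finset.mem_product.1 (Finset.mem_coe.1 hp)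
        obtain ⟨hc, he⟩ := Finset.mem_product.1 (Finset.mem_coe.1 hq)
        simp only at h ha hb hc he
        have h' : φ (a - c) = shift^[d] (φ (b - e)) := by
          rw [map_sub, map_sub, hsub]
          exact sub_eq_sub_iff_sub_eq_sub.1 h
        have hac : a = c := hinj a ha c hc fun i hi => by
          rw [h', shift_iterate_apply_of_lt _ _ _ hi]
        subst hac
        have hbe : φ (b - e) = 0 := by
          apply hshift d
          rw [← h', sub_self, map_zero, iterate_map_zero]
        have : b = e := hinj b hb e he fun i _ => by rw [hbe]; rfl
        rw [this]
    have h1 := hchain (d - 1)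
    rw [show d - 1 + 1 = d by omega] at h1
    have h2 : (F.card : ℝ) * F.card ≤ κ ^ d * F.card :=
      le_trans (by exact_mod_cast hbig) h1
    rw [hFcard] at h2
    exact le_of_mul_le_mul_right h2 hpos

/-! ### Planar sets with four small projections -/

/-- By pigeonhole some line `y + ρ x = c` contains many points of `T`; their first coordinates
form `E`. -/
theorem exists_popular_fibre (T : Finset (ℝ × ℝ)) (ρ : ℝ) {m : ℕ} (hm : 0 < m) {κ : ℝ}
    (hκ : 0 < κ) (hT : m ^ 2 ≤ T.card)
    (h : ((T.image fun p => p.2 + ρ * p.1).card : ℝ) ≤ κ * m) :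
    ∃ c : ℝ, ∃ E ⊆ T.image Prod.fst, (m : ℝ) ≤ κ * E.card ∧
      ∀ e ∈ E, c - ρ * e ∈ T.image Prod.snd := by
  classical
  have hT0 : T.Nonempty := Finset.card_pos.1 (lt_of_lt_of_le (by positivity) hT)
  obtain ⟨c, -, hc⟩ := Finset.exists_le_card_fiber_of_nsmul_le_card_of_maps_to
    (s := T) (t := T.image fun p => p.2 + ρ * p.1) (f := fun p => p.2 + ρ * p.1)
    (b := (m : ℝ) / κ) (fun p hp => Finset.mem_image_of_mem _ hp) (hT0.image _) (by
      rw [nsmul_eq_mul]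
      calc _ ≤ (κ * m) * (m / κ) := by gcongr
        _ = (m : ℝ) ^ 2 := by field_simp
        _ ≤ _ := by exact_mod_cast hT)
  refine ⟨c, (T.filter fun p => p.2 + ρ * p.1 = c).image Prod.fst,
    Finset.image_subset_image (Finset.filter_subset _ _), ?_, ?_⟩
  · rw [Finset.card_image_of_injOn]
    · rw [div_le_iff₀ hκ] at hc
      linarith
    · rintro ⟨a, b⟩ hp ⟨a', b'⟩ hq h
      have hp := (Finset.mem_filter.1 (Finset.mem_coe.1 hp)).2
      have hq := (Finset.mem_filter.1 (Finset.mem_coe.1 hq)).2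
      simp only at h hp hq
      subst h
      rw [Prod.mk.injEq]
      exact ⟨rfl, by linarith⟩
  · intro e he
    obtain ⟨⟨a, b⟩, hp, rfl⟩ := Finset.mem_image.1 he
    obtain ⟨hpT, hp⟩ := Finset.mem_filter.1 hp
    exact Finset.mem_image.2 ⟨_, hpT, by simp only at hp ⊢; linarith⟩

/-- If the projections of a planar set to two axes have small difference sets and two further
projections are small, then popular fibres of the latter give subsets `E`, `E'` of the first
projection such that `ρ E - ρ' E'` is small; the Ruzsa triangle inequality through `ρ' E'` bounds
`E - (ρ' / ρ) E`. The low rational dimension of the first projection then bounds the size of `E`. -/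
theorem log_le_mul_log_of_small_projections (T : Finset (ℝ × ℝ)) {ρ ρ' : ℝ} (hρ : ρ ≠ 0)
    (hρ' : ρ' ≠ 0) (htr : Transcendental ℚ (ρ' / ρ)) {m : ℕ} (hm : 0 < m) {κ : ℝ} (hκ : 1 ≤ κ)
    (hT : m ^ 2 ≤ T.card)
    (h₁ : ((T.image Prod.fst - T.image Prod.fst).card : ℝ) ≤ κ ^ 2 * m)
    (h₂ : ((T.image Prod.snd - T.image Prod.snd).card : ℝ) ≤ κ ^ 2 * m)
    (h₃ : ((T.image fun p => p.2 + ρ * p.1).card : ℝ) ≤ κ * m)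
    (h₄ : ((T.image fun p => p.2 + ρ' * p.1).card : ℝ) ≤ κ * m)
    (hd : (Module.finrank ℚ (vectorSpan ℚ (T.image Prod.fst : Set ℝ)) : ℝ) ≤ κ) :
    Real.log m ≤ 7 * κ * Real.log κ := by
  classical
  have hκ0 : 0 < κ := by linarith
  have hm0 : (0 : ℝ) < m := by exact_mod_cast hm
  set A := T.image Prod.fst with hA
  obtain ⟨c, E, hEA, hE, hEc⟩ := exists_popular_fibre T ρ hm hκ0 hT h₃
  obtain ⟨c', E', hEA', hE', hEc'⟩ := exists_popular_fibre T ρ' hm hκ0 hT h₄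
  have hinj : ∀ {t : ℝ}, t ≠ 0 → Function.Injective (t * ·) := fun ht => mul_right_injective₀ ht
  have htri := Finset.ruzsa_triangle_inequality_sub_sub_sub (E.image (ρ * ·))
    (E'.image (ρ' * ·)) (E.image (ρ' * ·))
  have hXZ : (E.image (ρ * ·) - E.image (ρ' * ·)).card =
      (E - E.image (ρ' / ρ * ·)).card := by
    rw [← Finset.card_image_of_injective (E - _) (hinj hρ)]
    congr 1
    have hmul : ∀ b : ℝ, ρ * (ρ' / ρ * b) = ρ' * b := fun b => by field_simp
    ext z
    simp only [Finset.mem_sub, Finset.mem_image]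
    constructor
    · rintro ⟨_, ⟨a, ha, rfl⟩, _, ⟨b, hb, rfl⟩, rfl⟩
      exact ⟨_, ⟨a, ha, _, ⟨b, hb, rfl⟩, rfl⟩, by rw [mul_sub, hmul]⟩
    · rintro ⟨_, ⟨a, ha, _, ⟨b, hb, rfl⟩, rfl⟩, rfl⟩
      exact ⟨_, ⟨a, ha, rfl⟩, _, ⟨b, hb, rfl⟩, by rw [mul_sub, hmul]⟩
  have hXY : (E.image (ρ * ·) - E'.image (ρ' * ·)).card ≤
      (T.image Prod.snd - T.image Prod.snd).card := by
    refine (Finset.card_le_card ?_).trans (Finset.card_image_le (f := fun x => c - c' - x))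
    intro z hz
    simp only [Finset.mem_sub, Finset.mem_image] at hz
    obtain ⟨_, ⟨a, ha, rfl⟩, _, ⟨b, hb, rfl⟩, rfl⟩ := hz
    exact Finset.mem_image.2 ⟨_, Finset.sub_mem_sub (hEc a ha) (hEc' b hb), by ring⟩
  have hZY : (E.image (ρ' * ·) - E'.image (ρ' * ·)).card ≤ (A - A).card := by
    refine (Finset.card_le_card ?_).trans (Finset.card_image_le (f := fun x => ρ' * x))
    intro z hz
    simp only [Finset.mem_sub, Finset.mem_image] at hz
    obtain ⟨_, ⟨a, ha, rfl⟩, _, ⟨b, hb, rfl⟩, rfl⟩ := hz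
    exact Finset.mem_image.2 ⟨_, Finset.sub_mem_sub (hEA ha) (hEA' hb), by ring⟩
  rw [hXZ, Finset.card_image_of_injective _ (hinj hρ')] at htri
  have htri' : ((E - E.image (ρ' / ρ * ·)).card : ℝ) * E'.card ≤ (κ ^ 2 * m) * (κ ^ 2 * m) := by
    calc _ ≤ ((E.image (ρ * ·) - E'.image (ρ' * ·)).card : ℝ) *
          (E.image (ρ' * ·) - E'.image (ρ' * ·)).card := by exact_mod_cast htri
      _ ≤ _ := by
        gcongr
        · exact (Nat.cast_le.2 hXY).trans h₂
        · exact (Nat.cast_le.2 hZY).trans h₁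
  have hEsmall : ((E - E.image (ρ' / ρ * ·)).card : ℝ) ≤ κ ^ 6 * E.card := by
    refine le_of_mul_le_mul_right ?_ hm0
    calc ((E - E.image (ρ' / ρ * ·)).card : ℝ) * m
        ≤ (E - E.image (ρ' / ρ * ·)).card * (κ * E'.card) := by gcongr
      _ = κ * ((E - E.image (ρ' / ρ * ·)).card * E'.card) := by ring
      _ ≤ κ * ((κ ^ 2 * m) * (κ ^ 2 * m)) := by gcongr
      _ = κ ^ 5 * m * m := by ring
      _ ≤ κ ^ 5 * (κ * E.card) * m := by gcongr
      _ = _ := by ring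
  have hEne : E.Nonempty := by
    rw [Finset.nonempty_iff_ne_empty]
    rintro rfl
    simp at hE
    omega
  set V := vectorSpan ℚ (A : Set ℝ)
  have : FiniteDimensional ℚ V := finiteDimensional_vectorSpan_of_finite ℚ A.finite_toSet
  have hpow := card_le_pow_of_card_sub_smul_le htr V E
    (fun x hx y hy => vsub_mem_vectorSpan ℚ (Finset.mem_coe.2 (hEA hx))
      (Finset.mem_coe.2 (hEA hy))) hEne hEsmall
  have hfin : (m : ℝ) ≤ κ ^ (6 * Module.finrank ℚ V + 1) := by
    calc (m : ℝ) ≤ κ * E.card := hE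
      _ ≤ κ * (κ ^ 6) ^ Module.finrank ℚ V := by gcongr
      _ = _ := by rw [← pow_mul, pow_succ']
  have hlog := Real.log_le_log hm0 hfin
  rw [Real.log_pow] at hlog
  push_cast at hlog
  have hlκ := Real.log_nonneg hκ
  calc _ ≤ _ := hlog
    _ ≤ (7 * κ) * Real.log κ := by gcongr; linarith

/-! ### Elementary estimates with logarithms -/

theorem log_div_log_log_le {x κ : ℝ} (hκ : 1 ≤ κ) (hx : 1 ≤ Real.log (Real.log x))
    (h : Real.log x ≤ 7 * κ * Real.log κ) :
    Real.log x / Real.log (Real.log x) ≤ 8 * κ := by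
  by_contra! hlt
  rw [lt_div_iff₀ (by linarith)] at hlt
  have hκx : κ ≤ Real.log x := by nlinarith
  have := Real.log_le_log (by linarith) hκx
  have h0 := Real.log_nonneg hκ
  nlinarith

/-- Passage from `log m ≤ 7 κ log κ`, with `m = ⌊c₁ N⌋` and `κ = D / m`, to a lower bound for `D`
valid for all `N ≥ 3`. -/
theorem exists_const_mul_log_div_log_log_le {c₁ : ℝ} (h0 : 0 < c₁) (h1 : c₁ ≤ 1) :
    ∃ c : ℝ, 0 < c ∧ ∀ N : ℕ, 3 ≤ N → ∀ D : ℝ, 1 ≤ D →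
      (0 < ⌊c₁ * N⌋₊ → (⌊c₁ * N⌋₊ : ℝ) ≤ D ∧
        Real.log ⌊c₁ * N⌋₊ ≤ 7 * (D / ⌊c₁ * N⌋₊) * Real.log (D / ⌊c₁ * N⌋₊)) →
      c * ((N : ℝ) * Real.log N / Real.log (Real.log N)) ≤ D := by
  set g : ℕ → ℝ := fun N => (N : ℝ) * Real.log N / Real.log (Real.log N) with hg
  -- For `N ≥ N₀` one has `√N ≤ ⌊c₁ N⌋` and `log (log √N) ≥ 1`; for smaller `N` the bound `1 ≤ D`
  -- suffices when `c` is small.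
  obtain ⟨N₀, hN₀⟩ := exists_nat_ge ((2 / c₁) ^ 2 + Real.exp (Real.exp 1) ^ 2)
  set M : ℝ := 1 + ∑ N ∈ Finset.range N₀, |g N| with hM
  have hMpos : 0 < M := by
    have : 0 ≤ ∑ N ∈ Finset.range N₀, |g N| := Finset.sum_nonneg fun _ _ => abs_nonneg _
    linarith
  refine ⟨min (c₁ / 32) (1 / M), lt_min (by positivity) (by positivity), ?_⟩
  intro N hN D hD hmD
  have hN3 : (3 : ℝ) ≤ N := by exact_mod_cast hN
  have hlogN : 1 < Real.log N := by
    rw [Real.lt_log_iff_exp_lt (by linarith)]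
    exact Real.exp_one_lt_three.trans_le hN3
  have hllN : 0 < Real.log (Real.log N) := Real.log_pos hlogN
  have hgpos : 0 ≤ g N := by positivity
  change min (c₁ / 32) (1 / M) * g N ≤ D
  rcases lt_or_ge N N₀ with hlt | hge
  · have hgM : g N ≤ M := by
      have := Finset.single_le_sum (f := fun N => |g N|) (fun i _ => abs_nonneg (g i))
        (Finset.mem_range.2 hlt)
      have := le_abs_self (g N)
      linarith
    calc _ ≤ 1 / M * M := by gcongr; exact min_le_right _ _
      _ = 1 := by field_simp
      _ ≤ D := hD
  · have hNbig : (2 / c₁) ^ 2 + Real.exp (Real.exp 1) ^ 2 ≤ N :=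
      hN₀.trans (by exact_mod_cast hge)
    have hs0 : 0 ≤ √(N : ℝ) := Real.sqrt_nonneg _
    have hss : √(N : ℝ) * √(N : ℝ) = N := Real.mul_self_sqrt (by positivity)
    have hs1 : 2 / c₁ ≤ √(N : ℝ) := Real.le_sqrt_of_sq_le (by nlinarith [Real.exp_pos (Real.exp 1)])
    have hs2 : Real.exp (Real.exp 1) ≤ √(N : ℝ) :=
      Real.le_sqrt_of_sq_le (by nlinarith [sq_nonneg (2 / c₁)])
    have hcs : 2 ≤ c₁ * √(N : ℝ) := by
      rw [div_le_iff₀ h0] at hs1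
      linarith
    have hs3 : 1 ≤ √(N : ℝ) := (Real.one_le_exp (Real.exp_pos 1).le).trans hs2
    set m := ⌊c₁ * N⌋₊ with hmdef
    have hmfl : c₁ * N < m + 1 := Nat.lt_floor_add_one _
    have hm1 : c₁ * N / 2 ≤ m := by nlinarith
    have hm2 : √(N : ℝ) ≤ m := by nlinarith
    have hmN : (m : ℝ) ≤ N := by
      have : (m : ℝ) ≤ c₁ * N := Nat.floor_le (by positivity)
      nlinarith
    have hm0 : 0 < m := by
      have : (0 : ℝ) < m := by linarith
      exact_mod_cast this
    have hm0' : (0 : ℝ) < m := by exact_mod_cast hm0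
    obtain ⟨hmD1, hmD2⟩ := hmD hm0
    have hlm : Real.log N / 2 ≤ Real.log m := by
      rw [← Real.log_sqrt (by positivity)]
      exact Real.log_le_log (by linarith) hm2
    have hlm1 : Real.exp 1 ≤ Real.log m := by
      rw [Real.le_log_iff_exp_le hm0']
      exact hs2.trans hm2
    have hllm : 1 ≤ Real.log (Real.log m) := by
      rw [Real.le_log_iff_exp_le (by linarith [Real.exp_pos 1])]
      exact hlm1
    have hllmN : Real.log (Real.log m) ≤ Real.log (Real.log N) :=
      Real.log_le_log (by linarith [Real.exp_pos 1]) (Real.log_le_log hm0' hmN)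
    have hκ : 1 ≤ D / m := by rwa [le_div_iff₀ hm0', one_mul]
    have hmain := log_div_log_log_le hκ hllm hmD2
    have hquot : Real.log N / 2 / Real.log (Real.log N) ≤ 8 * (D / m) := by
      refine le_trans ?_ hmain
      have : 0 ≤ Real.log m := by linarith [Real.exp_pos 1]
      gcongr
    calc _ ≤ c₁ / 32 * g N := by gcongr; exact min_le_left _ _
      _ = (c₁ * N / 2) / 8 * (Real.log N / 2 / Real.log (Real.log N)) := by
        simp only [hg]; field_simp; norm_num
      _ ≤ m / 8 * (8 * (D / m)) := by gcongr
      _ = D := by field_simp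

variable {E : Type*} [NormedAddCommGroup E] [NormedSpace ℝ E]

/-! ### Functionals attached to the sides of the unit ball -/

/-- The norm agrees with the functional `f` on some closed ball of positive radius, hence also on
all positive multiples of this ball. Functionals attached to the sides of the unit ball are of this
kind. -/
def IsNormNear (f : E →L[ℝ] ℝ) : Prop :=
  ∃ u : E, ∃ δ : ℝ, 0 < δ ∧ ∀ x : E, ‖x - u‖ ≤ δ → ‖x‖ = f x

theorem exists_eq_smul_add_smul (hdim : Module.finrank ℝ E = 2) {v w : E}
    (hli : LinearIndependent ℝ ![v, w]) (x : E) : ∃ s t : ℝ, x = s • v + t • w := by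
  have : Nonempty (Fin 2) := ⟨0⟩
  let e := basisOfLinearIndependentOfCardEqFinrank hli (by simp [hdim])
  refine ⟨e.repr x 0, e.repr x 1, ?_⟩
  have := e.sum_repr x
  rw [Fin.sum_univ_two] at this
  simpa [e] using this.symm

theorem IsSide.linearIndependent {p q : E} (h : IsSide p q) : LinearIndependent ℝ ![p, q] := by
  obtain ⟨hpq, -, -, hseg⟩ := h
  have hp : ‖p‖ = 1 := by simpa using hseg (left_mem_segment ℝ p q)
  have hq : ‖q‖ = 1 := by simpa using hseg (right_mem_segment ℝ p q)
  have hp0 : p ≠ 0 := by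
    rintro rfl
    simp at hp
  rw [LinearIndependent.pair_iff' hp0]
  rintro a rfl
  rw [norm_smul, hp, mul_one, Real.norm_eq_abs] at hq
  rcases eq_or_eq_neg_of_abs_eq hq with rfl | rfl
  · simp at hpq
  · have h0 : (0 : E) ∈ segment ℝ p ((-1 : ℝ) • p) :=
      ⟨1 / 2, 1 / 2, by norm_num, by norm_num, by norm_num, by simp⟩
    simpa using hseg h0

/-- The functional equal to `1` on the line through `p` and `q` coincides with the norm on the cone
spanned by `p` and `q`, whose interior contains `p + q`. -/
theorem IsSide.exists_functional (hdim : Module.finrank ℝ E = 2) {p q : E} (h : IsSide p q) :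
    ∃ f : E →L[ℝ] ℝ, f p = 1 ∧ f (q - p) = 0 ∧ IsNormNear f := by
  have : FiniteDimensional ℝ E := FiniteDimensional.of_finrank_pos (by omega)
  have hli := h.linearIndependent
  have : Nonempty (Fin 2) := ⟨0⟩
  let e := basisOfLinearIndependentOfCardEqFinrank hli (by simp [hdim])
  have he0 : e 0 = p := by simp [e]
  have he1 : e 1 = q := by simp [e]
  let l : E →L[ℝ] ℝ := (e.coord 0).toContinuousLinearMap
  let r : E →L[ℝ] ℝ := (e.coord 1).toContinuousLinearMap
  have hlp : l p = 1 := by simp [l, ← he0]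
  have hlq : l q = 0 := by simp [l, ← he1]
  have hrp : r p = 0 := by simp [r, ← he0]
  have hrq : r q = 1 := by simp [r, ← he1]
  have hx : ∀ x, x = l x • p + r x • q := by
    intro x
    have := e.sum_repr x
    rw [Fin.sum_univ_two, he0, he1] at this
    exact this.symm
  refine ⟨l + r, by simp [hlp, hrp], by simp [hlp, hrp, hlq, hrq], p + q, ?_⟩
  have hopen : IsOpen {x | 0 < l x ∧ 0 < r x} :=
    (isOpen_lt continuous_const l.continuous).inter (isOpen_lt continuous_const r.continuous)
  obtain ⟨δ, hδ, hball⟩ := Metric.isOpen_iff.1 hopen (p + q) (by simp [hlp, hrp, hlq, hrq])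
  refine ⟨δ / 2, by positivity, fun x hxδ => ?_⟩
  obtain ⟨hl, hr⟩ : 0 < l x ∧ 0 < r x := hball (by
    rw [Metric.mem_ball, dist_eq_norm]
    linarith)
  have hpos : 0 < l x + r x := by positivity
  have hmem : (l x / (l x + r x)) • p + (r x / (l x + r x)) • q ∈ segment ℝ p q :=
    ⟨_, _, by positivity, by positivity, by field_simp, rfl⟩
  have hnorm : ‖(l x / (l x + r x)) • p + (r x / (l x + r x)) • q‖ = 1 := by
    simpa using h.2.2.2 hmem
  have hxe : x = (l x + r x) • ((l x / (l x + r x)) • p + (r x / (l x + r x)) • q) := by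
    rw [smul_add, smul_smul, smul_smul, mul_div_cancel₀ _ hpos.ne', mul_div_cancel₀ _ hpos.ne']
    exact hx x
  rw [hxe, norm_smul, hnorm, mul_one, Real.norm_eq_abs, abs_of_pos hpos, ← hxe]
  rfl

theorem exists_isSide_transcendental (hdim : Module.finrank ℝ E = 2)
    (hslopes : ¬ HasAlgebraicSlopes E) {v w : E} (hli : LinearIndependent ℝ ![v, w]) :
    ∃ p q : E, IsSide p q ∧ ∃ x y : ℝ, q - p = x • v + y • w ∧ x ≠ 0 ∧
      Transcendental ℚ (y / x) := by
  have : Nonempty (Fin 2) := ⟨0⟩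
  let e := basisOfLinearIndependentOfCardEqFinrank hli (by simp [hdim])
  have hne : ¬ ∀ p q : E, IsSide p q → IsAlgebraicSlope (sideSlope e p q) :=
    fun h => hslopes ⟨e, h⟩
  push Not at hne
  obtain ⟨p, q, hpq, hs⟩ := hne
  have h0 : e.repr (q - p) 0 ≠ 0 := fun h => hs (Or.inl (by rw [sideSlope, if_pos h]))
  refine ⟨p, q, hpq, e.repr (q - p) 0, e.repr (q - p) 1, ?_, h0, ?_⟩
  · have := e.sum_repr (q - p)
    rw [Fin.sum_univ_two] at this
    simpa [e] using this.symm
  · exact fun h => hs (Or.inr ⟨_, by rw [sideSlope, if_neg h0], h⟩)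

/-- Four sides of the unit ball whose functionals, after rescaling, are `f`, `g`, `g + ρ f` and
`g + ρ' f` with `ρ' / ρ` transcendental. The coordinate system is adapted to the sides found
already: the first two get slopes `∞` and `0`, the third gets slope `1`, and the fourth
is a side whose slope is not algebraic in these coordinates. -/
theorem exists_four_functionals (hdim : Module.finrank ℝ E = 2)
    (hslopes : ¬ HasAlgebraicSlopes E) :
    ∃ f g h k : E →L[ℝ] ℝ, IsNormNear f ∧ IsNormNear g ∧ IsNormNear h ∧ IsNormNear k ∧
      (∃ w₁ w₂ : E, f w₁ = 1 ∧ f w₂ = 0 ∧ g w₁ = 0 ∧ g w₂ = 1) ∧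
      ∃ b b' ρ ρ' : ℝ, b ≠ 0 ∧ b' ≠ 0 ∧ ρ ≠ 0 ∧ ρ' ≠ 0 ∧ Transcendental ℚ (ρ' / ρ) ∧
        (∀ x, h x = b * (g x + ρ * f x)) ∧ ∀ x, k x = b' * (g x + ρ' * f x) := by
  have hside : ∃ p q : E, IsSide p q := by
    have : FiniteDimensional ℝ E := FiniteDimensional.of_finrank_pos (by omega)
    by_contra! hcon
    exact hslopes ⟨(Module.finBasisOfFinrankEq ℝ E hdim), fun p q h => (hcon p q h).elim⟩
  have hne0 : ∀ {y x : ℝ}, Transcendental ℚ (y / x) → y ≠ 0 := by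
    rintro y x h rfl
    exact h (by simpa using isAlgebraic_zero)
  obtain ⟨p₁, q₁, h₁⟩ := hside
  set v₁ := q₁ - p₁ with hv₁
  have hv₁0 : v₁ ≠ 0 := sub_ne_zero.2 h₁.1.symm
  obtain ⟨v₀, hli₀⟩ := exists_linearIndependent_pair_of_one_lt_finrank
    (show 1 < Module.finrank ℝ E by omega) hv₁0
  obtain ⟨p₂, q₂, h₂, x₂, y₂, hv₂, hx₂, -⟩ := exists_isSide_transcendental hdim hslopes
    (LinearIndependent.pair_symm_iff.1 hli₀)
  set v₂ := q₂ - p₂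
  have hli : LinearIndependent ℝ ![v₂, v₁] := by
    rw [LinearIndependent.pair_symm_iff, LinearIndependent.pair_iff' hv₁0]
    intro a ha
    have := LinearIndependent.pair_iff.1 hli₀ (a - y₂) (-x₂) (by
      rw [sub_smul, ha, hv₂, neg_smul]; abel)
    exact hx₂ (neg_eq_zero.1 this.2)
  obtain ⟨p₃, q₃, h₃, x₃, y₃, hv₃, hx₃, ht₃⟩ := exists_isSide_transcendental hdim hslopes hli
  have hy₃ := hne0 ht₃
  have hli' : LinearIndependent ℝ ![x₃ • v₂, y₃ • v₁] := by
    rw [LinearIndependent.pair_iff] at hli ⊢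
    intro s t hst
    rw [smul_smul, smul_smul] at hst
    obtain ⟨h1, h2⟩ := hli _ _ hst
    exact ⟨(mul_eq_zero.1 h1).resolve_right hx₃, (mul_eq_zero.1 h2).resolve_right hy₃⟩
  obtain ⟨p₄, q₄, h₄, x₄, y₄, hv₄, hx₄, ht₄⟩ := exists_isSide_transcendental hdim hslopes hli'
  have hy₄ := hne0 ht₄
  obtain ⟨f, hfp, hfv, hf⟩ := h₁.exists_functional hdim
  obtain ⟨g, hgp, hgv, hg⟩ := h₂.exists_functional hdim
  replace hfv : f v₁ = 0 := hfv
  replace hgv : g v₂ = 0 := hgv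
  obtain ⟨h, hhp, hhv, hh⟩ := h₃.exists_functional hdim
  obtain ⟨k, hkp, hkv, hk⟩ := h₄.exists_functional hdim
  have hspan := exists_eq_smul_add_smul hdim hli
  -- A functional that is nonzero somewhere cannot vanish on both `v₁` and `v₂`
  have hnz : ∀ (φ : E →L[ℝ] ℝ) (p : E), φ p = 1 → φ v₁ = 0 → φ v₂ ≠ 0 := by
    intro φ p hp h1 h2
    obtain ⟨s, t, rfl⟩ := hspan p
    simp [h1, h2] at hp
  have hfv₂ : f v₂ ≠ 0 := hnz f p₁ hfp hfv
  have hgv₁ : g v₁ ≠ 0 := fun h => hnz g p₂ hgp h hgv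
  have hrel : ∀ (φ : E →L[ℝ] ℝ) (p : E), φ p = 1 → ∀ x y : ℝ, x ≠ 0 → y ≠ 0 →
      φ (x • v₂ + y • v₁) = 0 → φ v₁ / g v₁ ≠ 0 ∧
      ∀ z, φ z = φ v₁ / g v₁ * (g z + -(y * g v₁ / (x * f v₂)) * f z) := by
    intro φ p hp x y hx hy h0
    simp only [map_add, map_smul, smul_eq_mul] at h0
    have hφ₁ : φ v₁ ≠ 0 := by
      intro h1
      rw [h1, mul_zero, add_zero] at h0
      exact hnz φ p hp h1 ((mul_eq_zero.1 h0).resolve_left hx)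
    refine ⟨div_ne_zero hφ₁ hgv₁, fun z => ?_⟩
    obtain ⟨s, t, rfl⟩ := hspan z
    simp only [map_add, map_smul, smul_eq_mul, hfv, hgv]
    field_simp
    linear_combination s * g v₁ * f v₂ * h0
  rw [hv₃] at hhv
  rw [hv₄, smul_smul, smul_smul] at hkv
  obtain ⟨hb, hh'⟩ := hrel h p₃ hhp x₃ y₃ hx₃ hy₃ hhv
  obtain ⟨hb', hk'⟩ := hrel k p₄ hkp _ _ (mul_ne_zero hx₄ hx₃) (mul_ne_zero hy₄ hy₃) hkv
  refine ⟨f, g, h, k, hf, hg, hh, hk, ⟨(f v₂)⁻¹ • v₂, (g v₁)⁻¹ • v₁, ?_, ?_, ?_, ?_⟩,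
    _, _, _, _, hb, hb', ?_, ?_, ?_, hh', hk'⟩
  · simp [hfv₂]
  · simp [hfv]
  · simp [hgv]
  · simp [hgv₁]
  · exact neg_ne_zero.2 (div_ne_zero (mul_ne_zero hy₃ hgv₁) (mul_ne_zero hx₃ hfv₂))
  · exact neg_ne_zero.2 (div_ne_zero (mul_ne_zero (mul_ne_zero hy₄ hy₃) hgv₁)
      (mul_ne_zero (mul_ne_zero hx₄ hx₃) hfv₂))
  · convert ht₄ using 1
    field_simp

/-- Two balls of radius `R`, one around the origin and the other around a point `o` at distance
`O(R)`, such that the norm of any difference between them is a difference of values of `f`. -/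
theorem IsNormNear.exists_far_centre {f : E →L[ℝ] ℝ} (hf : IsNormNear f) :
    ∃ B : ℝ, 0 ≤ B ∧ ∀ R : ℝ, 0 < R → ∃ o : E, ∀ x y : E, ‖x‖ ≤ R → ‖y - o‖ ≤ R →
      ‖x - y‖ = f x - f y ∧ ‖x - y‖ ≤ B * R := by
  obtain ⟨u, δ, hδ, hu⟩ := hf
  refine ⟨2 * ‖u‖ / δ + 2, by positivity, fun R hR => ⟨-((2 * R / δ) • u), fun x y hx hy => ?_⟩⟩
  have hr : 0 < 2 * R / δ := by positivity
  have hxy : ‖(x - y) - (2 * R / δ) • u‖ ≤ 2 * R := by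
    calc _ = ‖x - (y - -((2 * R / δ) • u))‖ := by congr 1; abel
      _ ≤ ‖x‖ + ‖y - -((2 * R / δ) • u)‖ := norm_sub_le _ _
      _ ≤ _ := by linarith
  constructor
  · have h1 : ‖(2 * R / δ)⁻¹ • (x - y) - u‖ ≤ δ := by
      have : (2 * R / δ)⁻¹ • (x - y) - u = (2 * R / δ)⁻¹ • ((x - y) - (2 * R / δ) • u) := by
        rw [smul_sub _ (x - y), smul_smul, inv_mul_cancel₀ hr.ne', one_smul]
      rw [this, norm_smul, Real.norm_eq_abs, abs_of_pos (inv_pos.2 hr)]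
      calc _ ≤ (2 * R / δ)⁻¹ * (2 * R) := by gcongr
        _ = δ := by field_simp
    have h2 := hu _ h1
    rw [norm_smul, map_smul, Real.norm_eq_abs, abs_of_pos (inv_pos.2 hr), smul_eq_mul] at h2
    rw [mul_left_cancel₀ (inv_pos.2 hr).ne' h2, map_sub]
  · calc ‖x - y‖ = ‖((x - y) - (2 * R / δ) • u) + (2 * R / δ) • u‖ := by congr 1; abel
      _ ≤ ‖(x - y) - (2 * R / δ) • u‖ + ‖(2 * R / δ) • u‖ := norm_add_le _ _
      _ ≤ 2 * R + 2 * R / δ * ‖u‖ := by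
        rw [norm_smul, Real.norm_eq_abs, abs_of_pos hr]; linarith
      _ = _ := by ring

/-! ### Distances between grid-like subsets of a well-distributed set -/

/-- Points `s o i j` of `S` close to the points of a square grid with origin `o` in the
coordinates `(f, g)`. The mesh is so wide that `f` and `g` separate different columns and rows. -/
theorem WellDistributed.exists_grid {S : Set E} (hS : WellDistributed S) (f g : E →L[ℝ] ℝ)
    {w₁ w₂ : E} (hf₁ : f w₁ = 1) (hf₂ : f w₂ = 0) (hg₁ : g w₁ = 0) (hg₂ : g w₂ = 1) :
    ∃ H : ℝ, 0 < H ∧ ∃ s : E → ℕ → ℕ → E, (∀ o i j, s o i j ∈ S) ∧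
      (∀ o i j i' j', i < i' → f (s o i j) < f (s o i' j')) ∧
      (∀ o i j i' j', j < j' → g (s o i j) < g (s o i' j')) ∧
      ∀ m : ℕ, 0 < m → ∀ o, ∀ i < 2 * m, ∀ j < 2 * m, ‖s o i j - o‖ ≤ H * m := by
  obtain ⟨K, hK⟩ := hS
  choose r hrS hr using hK
  have hK0 : 0 ≤ K := (norm_nonneg _).trans (hr 0)
  -- Moving to `S` changes `f` and `g` by at most `‖f‖ * K` and `‖g‖ * K`, less than
  -- half the mesh `L`.
  set L : ℝ := 2 * (‖f‖ + ‖g‖) * K + 1 with hL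
  have hfK : 0 ≤ ‖f‖ * K := by positivity
  have hgK : 0 ≤ ‖g‖ * K := by positivity
  have hL0 : 0 < L := by positivity
  have hclose : ∀ (φ : E →L[ℝ] ℝ) x, |φ x - φ (r x)| ≤ ‖φ‖ * K := by
    intro φ x
    rw [← map_sub, ← Real.norm_eq_abs]
    exact (φ.le_opNorm _).trans (by gcongr; exact hr x)
  let P : E → ℕ → ℕ → E := fun o i j => o + ((L * i) • w₁ + (L * j) • w₂)
  have hfP : ∀ o i j, f (P o i j) = f o + L * i := by
    intro o i j; simp [P, hf₁, hf₂]
  have hgP : ∀ o i j, g (P o i j) = g o + L * j := by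
    intro o i j; simp [P, hg₁, hg₂]
  refine ⟨2 * L * (‖w₁‖ + ‖w₂‖) + K + 1, by positivity, fun o i j => r (P o i j),
    fun o i j => hrS _, ?_, ?_, ?_⟩
  · intro o i j i' j' hlt
    have h1 := abs_le.1 (hclose f (P o i j))
    have h2 := abs_le.1 (hclose f (P o i' j'))
    rw [hfP] at h1 h2
    have h3 : (i : ℝ) + 1 ≤ i' := by exact_mod_cast hlt
    have h4 : L * (i + 1) ≤ L * i' := by gcongr
    linarith
  · intro o i j i' j' hlt
    have h1 := abs_le.1 (hclose g (P o i j))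
    have h2 := abs_le.1 (hclose g (P o i' j'))
    rw [hgP] at h1 h2
    have h3 : (j : ℝ) + 1 ≤ j' := by exact_mod_cast hlt
    have h4 : L * (j + 1) ≤ L * j' := by gcongr
    linarith
  · intro m hm o i hi j hj
    have hm1 : (1 : ℝ) ≤ m := by exact_mod_cast hm
    have hi' : (i : ℝ) ≤ 2 * m := by exact_mod_cast hi.le
    have hj' : (j : ℝ) ≤ 2 * m := by exact_mod_cast hj.le
    calc ‖r (P o i j) - o‖
        = ‖((L * i) • w₁ + (L * j) • w₂) - (P o i j - r (P o i j))‖ := by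
          congr 1; simp only [P]; abel
      _ ≤ ‖(L * i) • w₁‖ + ‖(L * j) • w₂‖ + K :=
          (norm_sub_le _ _).trans (add_le_add (norm_add_le _ _) (hr _))
      _ = L * i * ‖w₁‖ + L * j * ‖w₂‖ + K := by
          rw [norm_smul, norm_smul, Real.norm_of_nonneg (by positivity),
            Real.norm_of_nonneg (by positivity)]
      _ ≤ L * (2 * m) * ‖w₁‖ + L * (2 * m) * ‖w₂‖ + K * m := by
          gcongr
          nlinarith
      _ ≤ _ := by nlinarith

theorem image_sub_image_subset_distances {S : Set E} {N : ℕ}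
    (hfin : (distancesUpTo S N).Finite) {φ : E →L[ℝ] ℝ} {o : E} {R : ℝ}
    (ho : ∀ x y : E, ‖x‖ ≤ R → ‖y - o‖ ≤ R → ‖x - y‖ = φ x - φ y ∧ ‖x - y‖ ≤ N)
    {X Y : Finset E} (hX : ∀ x ∈ X, x ∈ S ∧ ‖x‖ ≤ R) (hY : ∀ y ∈ Y, y ∈ S ∧ ‖y - o‖ ≤ R) :
    X.image φ - Y.image φ ⊆ hfin.toFinset := by
  intro z hz
  obtain ⟨_, h1, _, h2, rfl⟩ := Finset.mem_sub.1 hz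
  obtain ⟨x, hx, rfl⟩ := Finset.mem_image.1 h1
  obtain ⟨y, hy, rfl⟩ := Finset.mem_image.1 h2
  obtain ⟨h3, h4⟩ := ho x y (hX x hx).2 (hY y hy).2
  rw [Set.Finite.mem_toFinset]
  exact ⟨h3 ▸ h4, x, (hX x hx).1, y, (hY y hy).1, h3.symm⟩

theorem card_sub_self_le {A B : Finset ℝ} {m D : ℕ} (hm : 0 < m) (hB : m ≤ B.card)
    (h : (A - B).card ≤ D) : ((A - A).card : ℝ) ≤ ((D : ℝ) / m) ^ 2 * m := by
  have htri := Finset.ruzsa_triangle_inequality_sub_sub_sub A B A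
  have h1 : (A - A).card * m ≤ D * D :=
    (Nat.mul_le_mul_left _ hB).trans (htri.trans (Nat.mul_le_mul h h))
  have h2 : ((A - A).card : ℝ) * m ≤ D * D := by exact_mod_cast h1
  have hm0 : (0 : ℝ) < m := by exact_mod_cast hm
  rw [div_pow, div_mul_eq_mul_div, le_div_iff₀ (by positivity)]
  nlinarith

/-- With `m` proportional to `N` and `κ` the number of distances up to `N` divided by `m`, an
`m × m` grid-like subset of `S` satisfies the hypotheses of `log_le_mul_log_of_small_projections`.
Each of the four functionals `φ` maps differences between this set and a distant grid to distances.
The bound on the rational dimension comes from doubling the set in the direction of larger `f`. -/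
theorem exists_scale_log_le (hdim : Module.finrank ℝ E = 2)
    (hslopes : ¬ HasAlgebraicSlopes E) {S : Set E} (hS : WellDistributed S) :
    ∃ c : ℝ, 0 < c ∧ c ≤ 1 ∧ ∀ N : ℕ, (hfin : (distancesUpTo S N).Finite) →
      0 < ⌊c * N⌋₊ → (⌊c * N⌋₊ : ℝ) ≤ hfin.toFinset.card ∧
        Real.log ⌊c * N⌋₊ ≤ 7 * (hfin.toFinset.card / ⌊c * N⌋₊) *
          Real.log (hfin.toFinset.card / ⌊c * N⌋₊) := by
  classical
  obtain ⟨f, g, h, k, hf, hg, hh, hk, ⟨w₁, w₂, hfw₁, hfw₂, hgw₁, hgw₂⟩, b, b', ρ, ρ', hb, hb',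
    hρ, hρ', htr, hh', hk'⟩ := exists_four_functionals hdim hslopes
  obtain ⟨H, hH, s, hsS, hsf, hsg, hsH⟩ := hS.exists_grid f g hfw₁ hfw₂ hgw₁ hgw₂
  obtain ⟨B₁, hB₁, hf⟩ := hf.exists_far_centre
  obtain ⟨B₂, hB₂, hg⟩ := hg.exists_far_centre
  obtain ⟨B₃, hB₃, hh⟩ := hh.exists_far_centre
  obtain ⟨B₄, hB₄, hk⟩ := hk.exists_far_centre
  set Q := 1 + (B₁ + B₂ + B₃ + B₄) * H with hQ
  have hQ1 : 1 ≤ Q := by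
    have : 0 ≤ (B₁ + B₂ + B₃ + B₄) * H := by positivity
    linarith
  refine ⟨1 / Q, by positivity, by rw [div_le_one (by linarith)]; exact hQ1, ?_⟩
  intro N hfin hm
  set m := ⌊1 / Q * N⌋₊ with hmdef
  set D := hfin.toFinset.card with hD
  have hm0 : (0 : ℝ) < m := by exact_mod_cast hm
  have hmN : Q * m ≤ N := by
    have : (m : ℝ) ≤ 1 / Q * N := Nat.floor_le (by positivity)
    calc Q * m ≤ Q * (1 / Q * N) := by gcongr
      _ = N := by field_simp
  have hR : 0 < H * m := by positivity
  -- Every functional has a centre whose distance to the origin is at most comparable to `N`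
  have hcentre : ∀ (φ : E →L[ℝ] ℝ) (B : ℝ), B ≤ B₁ + B₂ + B₃ + B₄ →
      (∀ R : ℝ, 0 < R → ∃ o : E, ∀ x y : E, ‖x‖ ≤ R → ‖y - o‖ ≤ R →
        ‖x - y‖ = φ x - φ y ∧ ‖x - y‖ ≤ B * R) →
      ∃ o : E, ∀ x y : E, ‖x‖ ≤ H * m → ‖y - o‖ ≤ H * m →
        ‖x - y‖ = φ x - φ y ∧ ‖x - y‖ ≤ N := by
    intro φ B hB hφ
    obtain ⟨o, ho⟩ := hφ _ hR
    refine ⟨o, fun x y hx hy => ⟨(ho x y hx hy).1, (ho x y hx hy).2.trans ?_⟩⟩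
    calc B * (H * m) ≤ (B₁ + B₂ + B₃ + B₄) * (H * m) := by gcongr
      _ ≤ Q * m := by rw [hQ]; nlinarith
      _ ≤ N := hmN
  obtain ⟨o₁, ho₁⟩ := hcentre f B₁ (by linarith) hf
  obtain ⟨o₂, ho₂⟩ := hcentre g B₂ (by linarith) hg
  obtain ⟨o₃, ho₃⟩ := hcentre h B₃ (by linarith) hh
  obtain ⟨o₄, ho₄⟩ := hcentre k B₄ (by linarith) hk
  -- `Y` contains `m` points at which `f` exceeds all its values on the grid `X`
  let X : Finset E := (Finset.range m ×ˢ Finset.range m).image fun p => s 0 p.1 p.2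
  let Y : Finset E := (Finset.range (2 * m)).image fun i => s 0 i 0
  let Z₁ : E → Finset E := fun o => (Finset.range m).image fun i => s o i 0
  let Z₂ : E → Finset E := fun o => (Finset.range m).image fun j => s o 0 j
  have hX : ∀ x ∈ X, x ∈ S ∧ ‖x‖ ≤ H * m := by
    intro x hx
    obtain ⟨⟨i, j⟩, hij, rfl⟩ := Finset.mem_image.1 hx
    rw [Finset.mem_product, Finset.mem_range, Finset.mem_range] at hij
    simp only at hij
    exact ⟨hsS _ _ _, by simpa using hsH m hm 0 i (by omega) j (by omega)⟩
  have hY : ∀ x ∈ Y, x ∈ S ∧ ‖x‖ ≤ H * m := by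
    intro x hx
    obtain ⟨i, hi, rfl⟩ := Finset.mem_image.1 hx
    rw [Finset.mem_range] at hi
    exact ⟨hsS _ _ _, by simpa using hsH m hm 0 i (by omega) 0 (by omega)⟩
  have hZ₁ : ∀ o, ∀ x ∈ Z₁ o, x ∈ S ∧ ‖x - o‖ ≤ H * m := by
    intro o x hx
    obtain ⟨i, hi, rfl⟩ := Finset.mem_image.1 hx
    rw [Finset.mem_range] at hi
    exact ⟨hsS _ _ _, hsH m hm o i (by omega) 0 (by omega)⟩
  have hZ₂ : ∀ o, ∀ x ∈ Z₂ o, x ∈ S ∧ ‖x - o‖ ≤ H * m := by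
    intro o x hx
    obtain ⟨i, hi, rfl⟩ := Finset.mem_image.1 hx
    rw [Finset.mem_range] at hi
    exact ⟨hsS _ _ _, hsH m hm o 0 (by omega) i (by omega)⟩
  have hfmono : ∀ o, StrictMono fun i => f (s o i 0) := fun o i i' hlt => hsf o i 0 i' 0 hlt
  have hgmono : ∀ o, StrictMono fun j => g (s o 0 j) := fun o j j' hlt => hsg o 0 j 0 j' hlt
  have hZ₁card : ((Z₁ o₁).image f).card = m := by
    rw [Finset.image_image]
    exact (Finset.card_image_of_injective _ (hfmono o₁).injective).trans (Finset.card_range m)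
  have hZ₂card : ((Z₂ o₂).image g).card = m := by
    rw [Finset.image_image]
    exact (Finset.card_image_of_injective _ (hgmono o₂).injective).trans (Finset.card_range m)
  have hZ₁ne : ∀ o, (Z₁ o).Nonempty := fun o => (Finset.nonempty_range_iff.2 hm.ne').image _
  have hXne : X.Nonempty :=
    ((Finset.nonempty_range_iff.2 hm.ne').product (Finset.nonempty_range_iff.2 hm.ne')).image _
  have hXf : (X.image f - (Z₁ o₁).image f).card ≤ D :=
    Finset.card_le_card (image_sub_image_subset_distances hfin ho₁ hX (hZ₁ o₁))
  have hXg : (X.image g - (Z₂ o₂).image g).card ≤ D :=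
    Finset.card_le_card (image_sub_image_subset_distances hfin ho₂ hX (hZ₂ o₂))
  have hXh : (X.image h).card ≤ D :=
    (Finset.card_le_card_sub_right ((hZ₁ne o₃).image h)).trans
      (Finset.card_le_card (image_sub_image_subset_distances hfin ho₃ hX (hZ₁ o₃)))
  have hXk : (X.image k).card ≤ D :=
    (Finset.card_le_card_sub_right ((hZ₁ne o₄).image k)).trans
      (Finset.card_le_card (image_sub_image_subset_distances hfin ho₄ hX (hZ₁ o₄)))
  have hmD : m ≤ D := by
    rw [← hZ₁card]
    exact (Finset.card_le_card_sub_left (hXne.image f)).trans hXf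
  have hdimle : m * Module.finrank ℚ (vectorSpan ℚ (X.image f : Set ℝ)) ≤ D := by
    refine (mul_finrank_vectorSpan_le_card_add m ((X ∪ Y).image f) (-((Z₁ o₁).image f))
      (X.image f) (Finset.image_subset_image Finset.subset_union_left)
      (by rw [Finset.card_neg, hZ₁card]) ?_).trans ?_
    · calc m = ((Finset.Ico m (2 * m)).image fun i => f (s 0 i 0)).card := by
            rw [Finset.card_image_of_injective _ (hfmono 0).injective, Nat.card_Ico]
            omega
        _ ≤ _ := Finset.card_le_card ?_
      intro z hz
      obtain ⟨i, hi, rfl⟩ := Finset.mem_image.1 hz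
      rw [Finset.mem_Ico] at hi
      refine Finset.mem_filter.2 ⟨Finset.mem_image_of_mem _ (Finset.mem_union_right _
        (Finset.mem_image.2 ⟨i, Finset.mem_range.2 hi.2, rfl⟩)), ?_⟩
      intro y hy
      obtain ⟨x, hx, rfl⟩ := Finset.mem_image.1 hy
      obtain ⟨⟨i', j'⟩, hij, rfl⟩ := Finset.mem_image.1 hx
      rw [Finset.mem_product, Finset.mem_range, Finset.mem_range] at hij
      exact hsf 0 i' j' i 0 (hij.1.trans_le hi.1)
    · rw [← sub_eq_add_neg]
      refine Finset.card_le_card (image_sub_image_subset_distances hfin ho₁ ?_ (hZ₁ o₁))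
      intro x hx
      rcases Finset.mem_union.1 hx with hx | hx
      exacts [hX x hx, hY x hx]
  let T : Finset (ℝ × ℝ) := X.image fun x => (f x, g x)
  have hTfst : T.image Prod.fst = X.image f := by
    rw [Finset.image_image]; rfl
  have hTsnd : T.image Prod.snd = X.image g := by
    rw [Finset.image_image]; rfl
  have hTcard : m ^ 2 ≤ T.card := by
    have hinj : Function.Injective fun p : ℕ × ℕ => (f (s 0 p.1 p.2), g (s 0 p.1 p.2)) := by
      rintro ⟨i, j⟩ ⟨i', j'⟩ hij
      rw [Prod.mk.injEq] at hij ⊢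
      constructor
      · by_contra hne
        rcases Nat.lt_or_gt_of_ne hne with hlt | hlt
        exacts [(hsf 0 i j i' j' hlt).ne hij.1, (hsf 0 i' j' i j hlt).ne' hij.1]
      · by_contra hne
        rcases Nat.lt_or_gt_of_ne hne with hlt | hlt
        exacts [(hsg 0 i j i' j' hlt).ne hij.2, (hsg 0 i' j' i j hlt).ne' hij.2]
    have hT : T = (Finset.range m ×ˢ Finset.range m).image
        fun p : ℕ × ℕ => (f (s 0 p.1 p.2), g (s 0 p.1 p.2)) := by
      simp only [T, X, Finset.image_image]
      rfl
    rw [hT, Finset.card_image_of_injective _ hinj, Finset.card_product, Finset.card_range, sq]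
  have hproj : ∀ (φ : E →L[ℝ] ℝ) (b ρ : ℝ), b ≠ 0 → (∀ x, φ x = b * (g x + ρ * f x)) →
      (X.image φ).card ≤ D →
      ((T.image fun p => p.2 + ρ * p.1).card : ℝ) ≤ (D : ℝ) / m * m := by
    intro φ b ρ hb hφ hD
    rw [div_mul_cancel₀ _ hm0.ne']
    refine Nat.cast_le.2 (le_trans (le_of_eq ?_) hD)
    rw [← Finset.card_image_of_injective _ (mul_right_injective₀ hb), Finset.image_image,
      Finset.image_image]
    congr 2
    ext x
    exact (hφ x).symm
  refine ⟨by exact_mod_cast hmD, ?_⟩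
  refine log_le_mul_log_of_small_projections T hρ hρ' htr hm
    (by rw [le_div_iff₀ hm0, one_mul]; exact_mod_cast hmD) hTcard ?_ ?_
    (hproj h b ρ hb hh' hXh) (hproj k b' ρ' hb' hk' hXk) ?_
  · rw [hTfst]
    exact card_sub_self_le hm hZ₁card.ge hXf
  · rw [hTsnd]
    exact card_sub_self_le hm hZ₂card.ge hXg
  · rw [hTfst, le_div_iff₀ hm0, mul_comm]
    exact_mod_cast hdimle

end PolygonalNorm

theorem theorem4 {E : Type*} [NormedAddCommGroup E] [NormedSpace ℝ E]
    (hdim : Module.finrank ℝ E = 2)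
    (hpoly : PolygonalNorm.UnitBallIsPolygon E)
    (hslopes : ¬ PolygonalNorm.HasAlgebraicSlopes E)
    (S : Set E) (hS : PolygonalNorm.WellDistributed S) :
    ∃ c : ℝ, 0 < c ∧ ∀ N : ℕ, 3 ≤ N →
      ENNReal.ofReal (c * ((N : ℝ) * Real.log N / Real.log (Real.log N))) ≤
        ((PolygonalNorm.distancesUpTo S N).encard : ℝ≥0∞) := by
  obtain ⟨c₁, hc₁, hc₁1, hmain⟩ := PolygonalNorm.exists_scale_log_le hdim hslopes hS
  obtain ⟨c, hc, hbound⟩ := PolygonalNorm.exists_const_mul_log_div_log_log_le hc₁ hc₁1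
  refine ⟨c, hc, fun N hN => ?_⟩
  by_cases hfin : (PolygonalNorm.distancesUpTo S N).Finite
  · have hone : 1 ≤ hfin.toFinset.card := by
      obtain ⟨K, hK⟩ := hS
      obtain ⟨a, ha, -⟩ := hK 0
      refine Finset.card_pos.2 ⟨0, hfin.mem_toFinset.2 ⟨by positivity, a, ha, a, ha, by simp⟩⟩
    rw [hfin.encard_eq_coe_toFinset_card]
    refine ENNReal.ofReal_le_of_le_toReal ?_
    simpa using hbound N hN hfin.toFinset.card (by exact_mod_cast hone) (hmain N hfin)
  · rw [Set.Infinite.encard_eq hfin]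
    simp
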